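/- Let $A$ be an arbitrary $C^*$-algebra and let $X$ be a Hilbert $C^*$-module over $A$. An unbounded operator $T : \mathrm{Dom}(T) \to X$ is called \emph{regular} if it is $A$-linear, densely defined and closed, its adjoint $T^*$ is densely defined, and $1 + T^*T$ has dense range. Let $D : \mathrm{Dom}(D) \to X$ be a selfadjoint and regular unbounded operator on $X$, and let $x : X \to X$ be a bounded adjointable operator with $x = x^*$ such that $x\xi \in \mathrm{Dom}(D)$ for all $\xi \in \mathrm{Dom}(D)$ and such that the commutator $[D,x] = Dx - xD : \mathrm{Dom}(D) \to X$ is bounded. Let $\delta(x) : X \to X$ denote the bounded extension of $[D,x]$, and let $Dx$ be the operator $\xi \mapsto D(x\xi)$ with domain $\mathrm{Dom}(Dx) = \{\xi \in X \mid x\xi \in \mathrm{Dom}(D)\}$. Then the operator $xD : \mathrm{Dom}(D) \to X$ is closable, its closure $\mathrm{cl}(xD)$ is regular, and \[ \mathrm{cl}(xD) = Dx - \delta(x) : \mathrm{Dom}(Dx) \to X, \] where the equality includes equality of domains. -/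

import Mathlib

/-!
Unbounded operators on a Hilbert C⋆-module `X` over a C⋆-algebra `A` are partially defined
linear maps `X →ₗ.[ℂ] X`.  In `CStarModule A X` the algebra acts from the left; right Hilbert
C⋆-modules over `B` are the case `A = Bᵐᵒᵖ`.
-/

namespace HilbertModule

/-- The graph of the adjoint of `T`: all pairs `(η, ζ)` such that
`⟪T ξ, η⟫ = ⟪ξ, ζ⟫` for every `ξ` in the domain of `T`. -/
def adjointGraph (A : Type*) {X : Type*} [NonUnitalCStarAlgebra A] [PartialOrder A] [SMul A X]
    [NormedAddCommGroup X] [NormedSpace ℂ X] [CStarModule A X] (T : X →ₗ.[ℂ] X) :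
    Submodule ℂ (X × X) where
  carrier := {p | ∀ ξ : T.domain, inner A (T ξ) p.1 = inner A (ξ : X) p.2}
  add_mem' := fun {p q} hp hq ξ => by
    simp only [Prod.fst_add, Prod.snd_add, CStarModule.inner_add_right]
    rw [hp ξ, hq ξ]
  zero_mem' := fun ξ => by simp
  smul_mem' := fun c p hp ξ => by
    simp only [Prod.smul_fst, Prod.smul_snd, CStarModule.inner_smul_right_complex]
    rw [hp ξ]

/-- The adjoint `T*` of a densely defined operator `T`. (For `T` densely defined `adjointGraph A T`
is the graph of an operator.) -/
noncomputable def adjoint (A : Type*) {X : Type*} [NonUnitalCStarAlgebra A] [PartialOrder A]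
    [SMul A X] [NormedAddCommGroup X] [NormedSpace ℂ X] [CStarModule A X] (T : X →ₗ.[ℂ] X) :
    X →ₗ.[ℂ] X :=
  (adjointGraph A T).toLinearPMap

/-- The composition `S T` of two unbounded operators, with its natural domain
`{ξ ∈ Dom(T) | T ξ ∈ Dom(S)}`. -/
def compose {X : Type*} [NormedAddCommGroup X] [NormedSpace ℂ X] (S T : X →ₗ.[ℂ] X) :
    X →ₗ.[ℂ] X where
  domain :=
    { carrier := {ξ | ∃ h : ξ ∈ T.domain, T ⟨ξ, h⟩ ∈ S.domain}
      add_mem' := by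
        rintro a b ⟨ha, ha'⟩ ⟨hb, hb'⟩
        refine ⟨T.domain.add_mem ha hb, ?_⟩
        have h := T.map_add ⟨a, ha⟩ ⟨b, hb⟩
        rw [AddMemClass.mk_add_mk] at h
        rw [h]
        exact S.domain.add_mem ha' hb'
      zero_mem' := ⟨T.domain.zero_mem, by
        have h : T ⟨0, T.domain.zero_mem⟩ = 0 := T.map_zero
        rw [h]
        exact S.domain.zero_mem⟩
      smul_mem' := by
        rintro c a ⟨ha, ha'⟩
        refine ⟨T.domain.smul_mem c ha, ?_⟩
        have h := T.map_smul c ⟨a, ha⟩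
        rw [SetLike.mk_smul_mk] at h
        rw [h]
        exact S.domain.smul_mem c ha' }
  toFun :=
    { toFun := fun ξ => S ⟨T ⟨ξ, ξ.2.1⟩, ξ.2.2⟩
      map_add' := fun ξ η => by
        rw [← S.map_add]
        congr 1
        exact Subtype.ext (T.map_add ⟨ξ, ξ.2.1⟩ ⟨η, η.2.1⟩)
      map_smul' := fun c ξ => by
        rw [RingHom.id_apply, ← S.map_smul]
        congr 1
        exact Subtype.ext (T.map_smul c ⟨ξ, ξ.2.1⟩) }

/-- The operator `D x` for an unbounded operator `D` and an everywhere defined bounded operator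
`x`, with domain `{ξ ∈ X | x ξ ∈ Dom(D)}`. -/
def mulRight {X : Type*} [NormedAddCommGroup X] [NormedSpace ℂ X] (D : X →ₗ.[ℂ] X)
    (x : X →L[ℂ] X) : X →ₗ.[ℂ] X :=
  D.comp ((x : X →ₗ[ℂ] X).toPMap (D.domain.comap (x : X →ₗ[ℂ] X))) (fun ξ => ξ.2)

/-- The operator `x D`, with domain `Dom(D)`. -/
def mulLeft {X : Type*} [NormedAddCommGroup X] [NormedSpace ℂ X] (x : X →L[ℂ] X)
    (D : X →ₗ.[ℂ] X) : X →ₗ.[ℂ] X :=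
  (x : X →ₗ[ℂ] X).compPMap D

/-- A regular operator on a Hilbert C⋆-module: an `A`-linear, densely defined, closed operator `T`
whose adjoint is densely defined and for which `1 + T* T` has dense range. -/
structure IsRegular (A : Type*) {X : Type*} [NonUnitalCStarAlgebra A] [PartialOrder A] [SMul A X]
    [NormedAddCommGroup X] [NormedSpace ℂ X] [CStarModule A X] (T : X →ₗ.[ℂ] X) : Prop where
  smul_mem : ∀ (a : A) (ξ : X), ξ ∈ T.domain → a • ξ ∈ T.domain
  map_smul : ∀ (a : A) (ξ : X) (h : ξ ∈ T.domain) (h' : a • ξ ∈ T.domain),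
    T ⟨a • ξ, h'⟩ = a • T ⟨ξ, h⟩
  isClosed : T.IsClosed
  dense_domain : Dense (T.domain : Set X)
  dense_adjoint_domain : Dense ((adjoint A T).domain : Set X)
  dense_range : Dense {η : X | ∃ ξ : (compose (adjoint A T) T).domain,
    (ξ : X) + compose (adjoint A T) T ξ = η}

/-- The commutator `[D, x] = D x - x D` with domain `Dom(D)`, where `x` preserves `Dom(D)`. -/
def commutator {X : Type*} [NormedAddCommGroup X] [NormedSpace ℂ X] (D : X →ₗ.[ℂ] X)
    (x : X →L[ℂ] X) (hx : ∀ ξ ∈ D.domain, x ξ ∈ D.domain) : D.domain →ₗ[ℂ] X :=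
  D.toFun ∘ₗ (x : X →ₗ[ℂ] X).restrict hx - (x : X →ₗ[ℂ] X) ∘ₗ D.toFun

/-- The extension `δ(x) : X → X` of the bounded operator `[D, x] : Dom(D) → X`, for `D` densely
defined. -/
noncomputable def delta {X : Type*} [NormedAddCommGroup X] [NormedSpace ℂ X] [CompleteSpace X]
    (D : X →ₗ.[ℂ] X) (x : X →L[ℂ] X) (hx : ∀ ξ ∈ D.domain, x ξ ∈ D.domain)
    (hb : ∃ C : ℝ, ∀ ξ : D.domain, ‖commutator D x hx ξ‖ ≤ C * ‖ξ‖) : X →L[ℂ] X :=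
  ((commutator D x hx).mkContinuousOfExistsBound hb).extend D.domain.subtypeL

end HilbertModule

/-! Write `G` for the graph of `D` and `T = Dx - δ`, whose graph is `twist G x δ`. Everything rests
on the resolvents `p = z(D+z)⁻¹` with `z = it`: they are contractions, map into Dom(D), commute with
`D` and tend strongly to 1 as `t → ∞`. Regularity of `D` supplies them.

`T` is closed and extends `xD`. Moving a resolvent past `x` costs only a term in `δ`, so `xD` is a
core of `T` (`twist_subset_closure`). Hence `cl(xD) = T`, and `Dx` lies in `T*` (`inner_twist`).

For regularity the main point is that `T + ir` is onto for real `|r| > 2‖δ‖` (`surj_twist`). The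
bounded operators `B = m x D p`, with `m` the adjoint of `p`, approximate `xD` weakly, and `B - B*`
is bounded by `‖δ‖` uniformly in `t`. Solutions of `(B + ir)u = w` for `w` in Dom(D) stay bounded in
the graph norm of `D` and form a Cauchy sequence. Their limit solves the equation weakly, and
selfadjointness of `D` turns this into a solution for `T`.

Finally `t² + (Dx)T = (T+it)(T-it) + δT` is a small perturbation of an invertible product for large
`t`. Positivity of `(Dx)T` allows the shift from `t²` to 1 (`exists_one_add_twist`). -/

namespace HilbertModule

open Filter Topology

/-! ### Resolvents of linear relations on a Banach space. -/

section Relation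

variable {X : Type*} [NormedAddCommGroup X] [NormedSpace ℂ X]

/-- `G + z` is bounded below by `c`, for a linear relation `G`. -/
def BoundedBelow (G : Submodule ℂ (X × X)) (z : ℂ) (c : ℝ) : Prop :=
  ∀ u v, (u, v) ∈ G → c * ‖u‖ ≤ ‖v + z • u‖

/-- `G + z` is surjective, for a linear relation `G`. -/
def Surj (G : Submodule ℂ (X × X)) (z : ℂ) : Prop :=
  ∀ w, ∃ u v, (u, v) ∈ G ∧ v + z • u = w

theorem BoundedBelow.eq_zero {G : Submodule ℂ (X × X)} {z : ℂ} {c : ℝ} (hc : 0 < c)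
    (h : BoundedBelow G z c) {u v : X} (huv : (u, v) ∈ G) (h0 : v + z • u = 0) : u = 0 := by
  have h1 := h u v huv
  rw [h0, norm_zero] at h1
  exact norm_le_zero_iff.1 (by nlinarith [norm_nonneg u])

theorem BoundedBelow.unique {G : Submodule ℂ (X × X)} {z : ℂ} {c : ℝ} (hc : 0 < c)
    (h : BoundedBelow G z c) {u v u' v' : X} (huv : (u, v) ∈ G) (huv' : (u', v') ∈ G)
    (h0 : v + z • u = v' + z • u') : u = u' := by
  refine sub_eq_zero.1 (h.eq_zero hc (G.sub_mem huv huv') ?_)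
  rw [smul_sub, sub_add_sub_comm, h0, sub_self]

/-- Neumann series. -/
theorem exists_add_apply_eq [CompleteSpace X] (K : X →L[ℂ] X) (hK : ‖K‖ < 1) (w : X) :
    ∃ u, u + K u = w := by
  let U := Units.oneSub (-K) (by rwa [norm_neg])
  refine ⟨(↑U⁻¹ : X →L[ℂ] X) w, ?_⟩
  have h : (U : X →L[ℂ] X) * (↑U⁻¹ : X →L[ℂ] X) = 1 := U.mul_inv
  have h2 := congrArg (fun f : X →L[ℂ] X => f w) h
  simpa [U] using h2

theorem exists_inverse {G : Submodule ℂ (X × X)} {z : ℂ} {c : ℝ} (hc : 0 < c)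
    (hb : BoundedBelow G z c) (hs : Surj G z) :
    ∃ R : X →L[ℂ] X, (∀ w, (R w, w - z • R w) ∈ G) ∧ (∀ w, c * ‖R w‖ ≤ ‖w‖) := by
  choose u v huv he using hs
  have hv : ∀ w, v w = w - z • u w := fun w => eq_sub_of_add_eq (he w)
  have hadd : ∀ a b, u (a + b) = u a + u b := fun a b =>
    hb.unique hc (huv _) (G.add_mem (huv a) (huv b)) (by
      rw [he, smul_add, add_add_add_comm, he, he])
  have hsmul : ∀ (k : ℂ) a, u (k • a) = k • u a := fun k a =>
    hb.unique hc (huv _) (G.smul_mem k (huv a)) (by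
      rw [he, smul_comm z k, ← smul_add, he])
  have hn : ∀ w, c * ‖u w‖ ≤ ‖w‖ := fun w => by simpa [he] using hb _ _ (huv w)
  let R₀ : X →ₗ[ℂ] X := { toFun := u, map_add' := hadd, map_smul' := hsmul }
  refine ⟨R₀.mkContinuous c⁻¹ fun w => ?_, fun w => ?_, fun w => hn w⟩
  · rw [inv_mul_eq_div, le_div_iff₀' hc]
    exact hn w
  · have := huv w
    rw [hv] at this
    exact this

/-- With `R = (G+z)⁻¹` one has `(G+z')R = 1 + (z'-z)R`, and `‖R‖ ≤ 1/c` makes this invertible. -/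
theorem Surj.of_norm_sub_lt [CompleteSpace X] {G : Submodule ℂ (X × X)} {z z' : ℂ} {c : ℝ}
    (hb : BoundedBelow G z c) (hs : Surj G z) (h : ‖z' - z‖ < c) : Surj G z' := by
  have hc : 0 < c := (norm_nonneg _).trans_lt h
  obtain ⟨R, hR, hRn⟩ := exists_inverse hc hb hs
  have hK : ‖(z' - z) • R‖ < 1 := by
    have h1 : ‖R‖ ≤ c⁻¹ := R.opNorm_le_bound (by positivity) fun w => by
      rw [inv_mul_eq_div, le_div_iff₀' hc]
      exact hRn w
    rw [norm_smul]
    calc ‖z' - z‖ * ‖R‖ ≤ ‖z' - z‖ * c⁻¹ := by gcongr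
      _ < c * c⁻¹ := by gcongr
      _ = 1 := mul_inv_cancel₀ hc.ne'
  intro w
  obtain ⟨w', hw'⟩ := exists_add_apply_eq _ hK w
  refine ⟨R w', w' - z • R w', hR w', ?_⟩
  rw [← hw', smul_apply, sub_smul]
  abel

/-- The lower bound on `u` also controls `v`, so `(u, v) ↦ v + zu` is bounded below on the complete
space `G` and has closed range. -/
theorem Surj.of_dense [CompleteSpace X] {G : Submodule ℂ (X × X)} {z : ℂ} {c : ℝ}
    (hG : IsClosed (G : Set (X × X))) (hc : 0 < c) (hb : BoundedBelow G z c)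
    (hd : Dense {w | ∃ u v, (u, v) ∈ G ∧ v + z • u = w}) : Surj G z := by
  have : CompleteSpace G := hG.completeSpace_coe
  let f : G →L[ℂ] X :=
    (ContinuousLinearMap.snd ℂ X X + z • ContinuousLinearMap.fst ℂ X X).comp G.subtypeL
  have hf : ∀ p : G, f p = p.1.2 + z • p.1.1 := fun p => rfl
  have hanti : ∀ p : G, ‖p‖ ≤ (1 + ‖z‖ / c + 1 / c) * ‖f p‖ := by
    rintro ⟨⟨u, v⟩, huv⟩
    have h1 := hb u v huv
    rw [hf]
    have h2 : ‖u‖ ≤ 1 / c * ‖v + z • u‖ := by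
      rw [one_div_mul_eq_div, le_div_iff₀' hc]
      exact h1
    have h3 : ‖v‖ ≤ ‖v + z • u‖ + ‖z‖ * ‖u‖ := by
      calc ‖v‖ = ‖(v + z • u) - z • u‖ := by rw [add_sub_cancel_right]
        _ ≤ _ := (norm_sub_le _ _).trans (by rw [norm_smul])
    have h4 : ‖z‖ * ‖u‖ ≤ ‖z‖ * (1 / c * ‖v + z • u‖) := by gcongr
    have h5 : 0 ≤ ‖z‖ * (1 / c * ‖v + z • u‖) := by positivity
    have h6 : (1 + ‖z‖ / c + 1 / c) * ‖v + z • u‖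
      = ‖v + z • u‖ + ‖z‖ * (1 / c * ‖v + z • u‖) + 1 / c * ‖v + z • u‖ := by ring
    change max ‖u‖ ‖v‖ ≤ (1 + ‖z‖ / c + 1 / c) * ‖v + z • u‖
    rw [h6]
    have h7 := norm_nonneg (v + z • u)
    have h8 : 0 ≤ 1 / c * ‖v + z • u‖ := by positivity
    exact max_le (by linarith) (by linarith)
  have hcl : IsClosed (Set.range f) :=
    (f.antilipschitz_of_bound (K := ⟨1 + ‖z‖ / c + 1 / c, by positivity⟩) hanti).isClosed_range
      f.uniformContinuous
  have hr : Set.range f = {w | ∃ u v, (u, v) ∈ G ∧ v + z • u = w} := by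
    ext w
    constructor
    · rintro ⟨⟨⟨u, v⟩, h⟩, rfl⟩
      exact ⟨u, v, h, rfl⟩
    · rintro ⟨u, v, h, rfl⟩
      exact ⟨⟨(u, v), h⟩, rfl⟩
  rw [← hr] at hd
  intro w
  have hw : w ∈ Set.range f := by
    rw [← hcl.closure_eq, hd.closure_eq]
    trivial
  rwa [hr] at hw

theorem surj_graph_of_boundedBelow [CompleteSpace X] (B : X →L[ℂ] X) {c t : ℝ} (hct : c < |t|)
    (hc : 0 ≤ c)
    (hb : ∀ t : ℝ, BoundedBelow (B : X →ₗ[ℂ] X).graph (t * Complex.I) (|t| - c)) :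
    Surj (B : X →ₗ[ℂ] X).graph (t * Complex.I) := by
  have ht : 0 < |t| := hc.trans_lt hct
  have ht0 : t ≠ 0 := abs_pos.1 ht
  -- Chosen so that `|kt| = |t| + ‖B‖`: the Neumann series works at `ikt`, and the distance back to
  -- `it` is `‖B‖`, less than the lower bound `|kt| - c`.
  let k : ℝ := 1 + ‖B‖ / |t|
  have hk : 0 ≤ ‖B‖ / |t| := by positivity
  have hkt : |k * t| = |t| + ‖B‖ := by
    rw [abs_mul, abs_of_nonneg (by positivity), add_mul, one_mul, div_mul_cancel₀ _ ht.ne']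
  have hz : (((k * t : ℝ) : ℂ) * Complex.I) ≠ 0 := by
    refine mul_ne_zero (Complex.ofReal_ne_zero.2 ?_) Complex.I_ne_zero
    exact abs_pos.1 (by rw [hkt]; positivity)
  refine Surj.of_norm_sub_lt (hb (k * t)) ?_ ?_
  · intro w
    obtain ⟨u, hu⟩ := exists_add_apply_eq ((((k * t : ℝ) : ℂ) * Complex.I)⁻¹ • B) (by
      rw [norm_smul, norm_inv, norm_mul, Complex.norm_real, Complex.norm_I, mul_one,
        Real.norm_eq_abs, hkt, inv_mul_eq_div, div_lt_one (by positivity)]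
      linarith) ((((k * t : ℝ) : ℂ) * Complex.I)⁻¹ • w)
    refine ⟨u, B u, rfl, ?_⟩
    have h2 := congrArg (fun y => (((k * t : ℝ) : ℂ) * Complex.I) • y) hu
    simp only [smul_apply, smul_add, smul_inv_smul₀ hz] at h2
    rw [add_comm, h2]
  · have h1 : (t : ℂ) * Complex.I - ((k * t : ℝ) : ℂ) * Complex.I
        = ((-(‖B‖ / |t| * t) : ℝ) : ℂ) * Complex.I := by
      simp only [k]
      push_cast
      ring
    rw [h1, norm_mul, Complex.norm_real, Complex.norm_I, mul_one, Real.norm_eq_abs, abs_neg,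
      abs_mul, abs_of_nonneg hk, div_mul_cancel₀ _ ht.ne', hkt]
    linarith

end Relation

/-! ### Estimates with the `A`-valued inner product. -/

section Inner

variable {A X : Type*} [NonUnitalCStarAlgebra A] [PartialOrder A] [StarOrderedRing A]
  [SMul A X] [NormedAddCommGroup X] [NormedSpace ℂ X] [CStarModule A X]

theorem tendsto_inner {ι : Type*} {l : Filter ι} {f g : ι → X} {u v : X}
    (hf : Tendsto f l (𝓝 u)) (hg : Tendsto g l (𝓝 v)) :
    Tendsto (fun i => (inner A (f i) (g i) : A)) l (𝓝 (inner A u v)) :=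
  ((CStarModule.continuous_inner (A := A) (E := X)).tendsto (u, v)).comp (hf.prodMk_nhds hg)

/-- The skew part of `⟪w, u⟫` for `w = v + itu` differs from that of `⟪v, u⟫` by a multiple `2t` of
`⟪u, u⟫`, whose norm is `‖u‖²`. The constant `c` measures the failure of symmetry. -/
theorem norm_lower_bound {u v : X} {c : ℝ}
    (h : ‖(inner A v u : A) - inner A u v‖ ≤ 2 * c * ‖u‖ ^ 2) (t : ℝ) :
    (|t| - c) * ‖u‖ ≤ ‖v + ((t : ℂ) * Complex.I) • u‖ := by
  set w := v + ((t : ℂ) * Complex.I) • u with hw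
  have h1 : (2 * (t : ℂ) * Complex.I) • (inner A u u : A)
      = ((inner A v u : A) - inner A u v) - (inner A w u - inner A u w) := by
    rw [hw]
    simp only [CStarModule.inner_add_left, CStarModule.inner_add_right,
      CStarModule.inner_smul_left_complex, CStarModule.inner_smul_right_complex, star_mul',
      Complex.star_def, Complex.conj_ofReal, Complex.conj_I]
    module
  have h2 : 2 * |t| * ‖u‖ ^ 2 ≤ 2 * c * ‖u‖ ^ 2 + (‖w‖ * ‖u‖ + ‖u‖ * ‖w‖) := by
    have h3 := congrArg norm h1
    rw [norm_smul, ← CStarModule.norm_sq_eq A, norm_mul, norm_mul, Complex.norm_I,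
      Complex.norm_real, Complex.norm_ofNat, Real.norm_eq_abs, mul_one] at h3
    rw [h3]
    refine (norm_sub_le _ _).trans (add_le_add h ((norm_sub_le _ _).trans ?_))
    exact add_le_add (CStarModule.norm_inner_le X) (CStarModule.norm_inner_le X)
  rcases (norm_nonneg u).eq_or_lt with h0 | h0
  · rw [← h0, mul_zero]
    exact norm_nonneg _
  · refine le_of_mul_le_mul_right ?_ h0
    nlinarith

theorem ext_inner_left_dense {S : Set X} (hS : Dense S) {u v : X}
    (h : ∀ w ∈ S, (inner A w u : A) = inner A w v) : u = v := by
  have h1 : ∀ w, (inner A w u : A) = inner A w v := fun w => by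
    refine hS.induction (P := fun w => (inner A w u : A) = inner A w v) h ?_ w
    exact isClosed_eq
      ((CStarModule.continuous_inner (A := A)).comp (continuous_id.prodMk continuous_const))
      ((CStarModule.continuous_inner (A := A)).comp (continuous_id.prodMk continuous_const))
  have h2 : (inner A (u - v) (u - v) : A) = 0 := by
    rw [CStarModule.inner_sub_right, h1, sub_self]
  exact sub_eq_zero.1 (CStarModule.inner_self.1 h2)

end Inner

/-! ### Symmetric relations and their resolvents on the imaginary axis. -/

section Symmetric

/-- A symmetric linear relation on a Hilbert module. -/
def Symm (A : Type*) {X : Type*} [NonUnitalCStarAlgebra A] [PartialOrder A] [SMul A X]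
    [NormedAddCommGroup X] [NormedSpace ℂ X] [CStarModule A X] (G : Submodule ℂ (X × X)) : Prop :=
  ∀ u v u' v', (u, v) ∈ G → (u', v') ∈ G → (inner A v u' : A) = inner A u v'

variable {A X : Type*} [NonUnitalCStarAlgebra A] [PartialOrder A] [StarOrderedRing A]
  [SMul A X] [NormedAddCommGroup X] [NormedSpace ℂ X] [CStarModule A X]
  {G : Submodule ℂ (X × X)}

theorem Symm.boundedBelow (hG : Symm A G) (t : ℝ) :
    BoundedBelow G ((t : ℂ) * Complex.I) |t| := fun u v huv => by
  have := norm_lower_bound (A := A) (u := u) (v := v) (c := 0)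
    (by rw [hG u v u v huv huv, sub_self]; simp) t
  simpa using this

/-- `p = z (G + z)⁻¹` and it is a contraction. -/
structure IsResolvent (G : Submodule ℂ (X × X)) (z : ℂ) (p : X →L[ℂ] X) : Prop where
  mem : ∀ w, (p w, z • (w - p w)) ∈ G
  apply_snd : ∀ u v, (u, v) ∈ G → p v = z • (u - p u)
  norm_apply_le : ∀ w, ‖p w‖ ≤ ‖w‖

theorem IsResolvent.apply_mem {z : ℂ} {p : X →L[ℂ] X} (h : IsResolvent G z p) {u v : X}
    (huv : (u, v) ∈ G) : (p u, p v) ∈ G := by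
  rw [h.apply_snd u v huv]
  exact h.mem u

theorem IsResolvent.norm_sub_apply_le {z : ℂ} {p : X →L[ℂ] X} (h : IsResolvent G z p) {u v : X}
    (huv : (u, v) ∈ G) : ‖z‖ * ‖u - p u‖ ≤ ‖v‖ := by
  rw [← norm_smul, ← h.apply_snd u v huv]
  exact h.norm_apply_le v

theorem Symm.exists_isResolvent (hG : Symm A G) {t : ℝ} (ht : t ≠ 0)
    (hs : Surj G ((t : ℂ) * Complex.I)) :
    ∃ p : X →L[ℂ] X, IsResolvent G ((t : ℂ) * Complex.I) p := by
  have ht' : 0 < |t| := abs_pos.2 ht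
  obtain ⟨R, hR, hRn⟩ := exists_inverse ht' (hG.boundedBelow t) hs
  set z := (t : ℂ) * Complex.I with hz
  have hnz : ‖z‖ = |t| := by simp [hz]
  have hm : ∀ w, ((z • R) w, z • (w - (z • R) w)) ∈ G := fun w => by
    simpa using G.smul_mem z (hR w)
  refine ⟨z • R, hm, fun u v huv => ?_, fun w => ?_⟩
  · have h1 : u = (z • R) u + R v := by
      refine (hG.boundedBelow t).unique ht' huv
        (G.add_mem (hm u) (hR v)) ?_
      simp only [smul_apply, smul_add, smul_sub, ← hz]
      abel
    rw [smul_apply]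
    congr 1
    rw [eq_sub_iff_add_eq, add_comm]
    exact h1.symm
  · rw [smul_apply, norm_smul, hnz]
    exact hRn w

/-- The conjugate of `it` is `-it`. Symmetry applied to the two graph elements leaves the claim once
the common term `⟪p u, m v⟫` cancels. -/
theorem Symm.inner_isResolvent (hG : Symm A G) {t : ℝ} (ht : t ≠ 0) {p m : X →L[ℂ] X}
    (hp : IsResolvent G ((t : ℂ) * Complex.I) p)
    (hm : IsResolvent G (((-t : ℝ) : ℂ) * Complex.I) m) (u v : X) :
    (inner A (p u) v : A) = inner A u (m v) := by
  have h := hG _ _ _ _ (hp.mem u) (hm.mem v)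
  have ht' : (t : ℂ) * Complex.I ≠ 0 :=
    mul_ne_zero (Complex.ofReal_ne_zero.2 ht) Complex.I_ne_zero
  simp only [CStarModule.inner_smul_left_complex, CStarModule.inner_smul_right_complex, star_mul',
      Complex.star_def, Complex.conj_ofReal, Complex.conj_I, Complex.ofReal_neg,
      CStarModule.inner_sub_left, CStarModule.inner_sub_right] at h
  rw [neg_mul, mul_neg] at h
  have h2 := smul_right_injective A (neg_ne_zero.2 ht') h
  exact (sub_left_inj.1 h2).symm

/-- The lower bound at `is` is `|s|`, so a move by `|s|/2` is allowed; repeating it makes the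
parameter grow geometrically. -/
theorem Symm.surj_pow [CompleteSpace X] (hG : Symm A G) {e : ℝ} (he : |e| = 1)
    (hs : Surj G ((e : ℂ) * Complex.I)) (k : ℕ) :
    Surj G (((e * (3 / 2) ^ k : ℝ) : ℂ) * Complex.I) := by
  induction k with
  | zero => simpa using hs
  | succ k ih =>
    refine ih.of_norm_sub_lt (hG.boundedBelow _) ?_
    have h1 : (((e * (3 / 2) ^ (k + 1) : ℝ) : ℂ) * Complex.I)
        - (((e * (3 / 2) ^ k : ℝ) : ℂ) * Complex.I)
        = (((e * (3 / 2) ^ k) * (1 / 2) : ℝ) : ℂ) * Complex.I := by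
      push_cast
      ring
    rw [h1, norm_mul, Complex.norm_I, mul_one, Complex.norm_real, Real.norm_eq_abs, abs_mul _ (1/2)]
    have h2 : 0 < |e * (3 / 2) ^ k| := by
      rw [abs_mul, he]
      positivity
    rw [abs_of_pos (by norm_num : (0 : ℝ) < 1 / 2)]
    linarith

/-- A sequence of resolvents, with parameters `t k` tending to infinity. -/
theorem Symm.exists_resolvents [CompleteSpace X] (hG : Symm A G)
    (hs : Surj G Complex.I) (hs' : Surj G (-Complex.I)) :
    ∃ p m : ℕ → X →L[ℂ] X,
      (∀ k, IsResolvent G ((((3 / 2) ^ k : ℝ) : ℂ) * Complex.I) (p k)) ∧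
      (∀ k, IsResolvent G (((-(3 / 2) ^ k : ℝ) : ℂ) * Complex.I) (m k)) := by
  have h1 : ∀ k : ℕ, ∃ p : X →L[ℂ] X,
      IsResolvent G ((((3 / 2) ^ k : ℝ) : ℂ) * Complex.I) p := fun k => by
    refine hG.exists_isResolvent (by positivity) ?_
    have := hG.surj_pow (e := 1) (by simp) (by simpa using hs) k
    rwa [one_mul] at this
  have h2 : ∀ k : ℕ, ∃ p : X →L[ℂ] X,
      IsResolvent G (((-(3 / 2) ^ k : ℝ) : ℂ) * Complex.I) p := fun k => by
    refine hG.exists_isResolvent (neg_ne_zero.2 (by positivity)) ?_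
    have := hG.surj_pow (e := -1) (by simp) (by simpa using hs') k
    rwa [neg_one_mul] at this
  choose p hp using h1
  choose m hm using h2
  exact ⟨p, m, hp, hm⟩

/-- On the domain `‖u - p u‖ ≤ ‖v‖/t`; the contraction bound extends convergence to all vectors by
density. -/
theorem tendsto_resolvents {p : ℕ → X →L[ℂ] X}
    (hd : Dense {u : X | ∃ v, (u, v) ∈ G})
    (hp : ∀ k, IsResolvent G ((((3 / 2) ^ k : ℝ) : ℂ) * Complex.I) (p k)) (w : X) :
    Tendsto (fun k => p k w) atTop (𝓝 w) := by
  have hpow : Tendsto (fun k : ℕ => ((3 / 2 : ℝ) ^ k)⁻¹) atTop (𝓝 0) :=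
    (tendsto_pow_atTop_atTop_of_one_lt (by norm_num)).inv_tendsto_atTop
  rw [Metric.tendsto_atTop]
  intro ε hε
  obtain ⟨u, hwu, v, huv⟩ := Metric.dense_iff.1 hd w (ε / 3) (by positivity)
  have hlim : Tendsto (fun k : ℕ => ((3 / 2 : ℝ) ^ k)⁻¹ * ‖v‖) atTop (𝓝 0) := by
    simpa using hpow.mul_const ‖v‖
  obtain ⟨N, hN⟩ := (hlim.eventually (gt_mem_nhds (by positivity : 0 < ε / 3))).exists_forall_of_atTop
  refine ⟨N, fun k hk => ?_⟩
  have h1 : ‖u - p k u‖ ≤ ((3 / 2 : ℝ) ^ k)⁻¹ * ‖v‖ := by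
    have := (hp k).norm_sub_apply_le huv
    rw [norm_mul, Complex.norm_I, mul_one, Complex.norm_real, Real.norm_eq_abs,
      abs_of_pos (by positivity)] at this
    rwa [inv_mul_eq_div, le_div_iff₀' (by positivity)]
  have h2 := hN k hk
  have h3 : ‖u - w‖ < ε / 3 := by simpa [dist_eq_norm] using hwu
  have h4 := (hp k).norm_apply_le (w - u)
  rw [dist_eq_norm]
  calc ‖p k w - w‖ = ‖p k (w - u) - (u - p k u) + (u - w)‖ := by
        congr 1
        rw [map_sub]
        abel
    _ ≤ ‖p k (w - u)‖ + ‖u - p k u‖ + ‖u - w‖ :=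
        (norm_add_le _ _).trans (by gcongr; exact norm_sub_le _ _)
    _ < ε := by
        rw [norm_sub_rev w u] at h4
        linarith

end Symmetric

/-! ### The operator `Dx - δ`: core, adjoint and lower bound. -/

section Commutator

variable {A X : Type*} [NonUnitalCStarAlgebra A] [PartialOrder A] [StarOrderedRing A]
  [SMul A X] [NormedAddCommGroup X] [NormedSpace ℂ X] [CStarModule A X]
  {G : Submodule ℂ (X × X)} {x δ : X →L[ℂ] X}

theorem Symm.single_valued (hG : Symm A G) (hd : Dense {u : X | ∃ v, (u, v) ∈ G}) {a b b' : X}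
    (h : (a, b) ∈ G) (h' : (a, b') ∈ G) : b = b' := by
  have h0 : ((0 : X), b - b') ∈ G := by simpa using G.sub_mem h h'
  refine sub_eq_zero.1 (ext_inner_left_dense (A := A) hd ?_)
  rintro w ⟨w', hw⟩
  rw [← hG _ _ _ _ hw h0, CStarModule.inner_zero_right, CStarModule.inner_zero_right]

/-- If `G` is the graph of `D`, this is the graph of `D x - δ`. -/
def twist (G : Submodule ℂ (X × X)) (x δ : X →L[ℂ] X) : Submodule ℂ (X × X) :=
  G.comap ((x : X →ₗ[ℂ] X).comp (LinearMap.fst ℂ X X) |>.prod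
    (LinearMap.snd ℂ X X + (δ : X →ₗ[ℂ] X).comp (LinearMap.fst ℂ X X)))

theorem mem_twist {u v : X} : (u, v) ∈ twist G x δ ↔ (x u, v + δ u) ∈ G := Iff.rfl

theorem isClosed_twist (hG : IsClosed (G : Set (X × X))) :
    IsClosed (twist G x δ : Set (X × X)) := by
  refine hG.preimage (f := fun p : X × X => (x p.1, p.2 + δ p.1)) ?_
  fun_prop

/-- `x D` is a core of `D x - δ`. -/
theorem twist_subset_closure (hd : Dense {u : X | ∃ v, (u, v) ∈ G})
    (hδ : ∀ u v, (u, v) ∈ G → (x u, x v + δ u) ∈ G) {p : ℕ → X →L[ℂ] X}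
    (hp : ∀ k, IsResolvent G ((((3 / 2) ^ k : ℝ) : ℂ) * Complex.I) (p k))
    {u v : X} (huv : (u, v) ∈ twist G x δ) :
    (u, v) ∈ closure {q : X × X | ∃ w, (q.1, w) ∈ G ∧ q.2 = x w} := by
  have hlim := tendsto_resolvents hd hp
  have hδlim : Tendsto (fun k => p k (δ (p k u))) atTop (𝓝 (δ u)) := by
    have h1 : Tendsto (fun k => δ (p k u) - δ u) atTop (𝓝 0) := by
      have := ((δ.continuous.tendsto u).comp (hlim u)).sub_const (δ u)
      simpa using this
    have h2 : Tendsto (fun k => p k (δ (p k u) - δ u)) atTop (𝓝 0) :=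
      squeeze_zero_norm (fun k => (hp k).norm_apply_le _) (by simpa using h1.norm)
    have h3 := h2.add (hlim (δ u))
    simpa [map_sub] using h3
  -- This is `x D p u = p(v + δu) - p δ p u`. The unbounded `D` no longer appears on the right,
  -- which tends to `v`.
  have hx : ∀ k, x (((((3 / 2) ^ k : ℝ) : ℂ) * Complex.I) • (u - p k u))
      = p k (v + δ u) - p k (δ (p k u)) := fun k => by
    have h1 := (hp k).apply_snd _ _ (hδ _ _ ((hp k).mem u))
    rw [(hp k).apply_snd _ _ (mem_twist.1 huv)]
    rw [map_add] at h1
    rw [eq_sub_of_add_eq' h1]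
    simp only [map_sub, map_smul]
    module
  refine mem_closure_of_tendsto (b := atTop)
    (f := fun k => (p k u, p k (v + δ u) - p k (δ (p k u)))) ?_ (Eventually.of_forall fun k => ?_)
  · have h := (hlim u).prodMk_nhds ((hlim (v + δ u)).sub hδlim)
    rwa [add_sub_cancel_right] at h
  · exact ⟨_, (hp k).mem u, (hx k).symm⟩

/-- `δ` is skew-adjoint. -/
theorem inner_skew (hd : Dense {u : X | ∃ v, (u, v) ∈ G}) (hG : Symm A G)
    (hxs : ∀ u v : X, (inner A (x u) v : A) = inner A u (x v))
    (hδ : ∀ u v, (u, v) ∈ G → (x u, x v + δ u) ∈ G) (u v : X) :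
    (inner A (δ u) v : A) = - inner A u (δ v) := by
  have hc := CStarModule.continuous_inner (A := A) (E := X)
  refine hd.induction (P := fun u => (inner A (δ u) v : A) = - inner A u (δ v)) ?_ ?_ u
  · rintro u ⟨u', hu⟩
    refine hd.induction (P := fun v => (inner A (δ u) v : A) = - inner A u (δ v)) ?_ ?_ v
    · rintro v ⟨v', hv⟩
      have h1 := hG _ _ _ _ (hδ _ _ hu) hv
      have h2 := hG _ _ _ _ hu (hδ _ _ hv)
      rw [CStarModule.inner_add_left, hxs, hxs] at h1
      rw [h2, CStarModule.inner_add_right, add_assoc] at h1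
      rw [eq_neg_iff_add_eq_zero, add_comm]
      exact add_eq_left.1 h1
    · exact isClosed_eq (hc.comp (continuous_const.prodMk continuous_id))
        (hc.comp (continuous_const.prodMk δ.continuous)).neg
  · exact isClosed_eq (hc.comp (δ.continuous.prodMk continuous_const))
      (hc.comp (continuous_id.prodMk continuous_const)).neg

/-- `D x` is contained in the adjoint of `D x - δ`. -/
theorem inner_twist (hd : Dense {u : X | ∃ v, (u, v) ∈ G}) (hG : Symm A G)
    (hxs : ∀ u v : X, (inner A (x u) v : A) = inner A u (x v))
    (hδ : ∀ u v, (u, v) ∈ G → (x u, x v + δ u) ∈ G) {p : ℕ → X →L[ℂ] X}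
    (hp : ∀ k, IsResolvent G ((((3 / 2) ^ k : ℝ) : ℂ) * Complex.I) (p k))
    {a b u v : X} (hab : (a, b) ∈ twist G x δ) (huv : (x u, v) ∈ G) :
    (inner A b u : A) = inner A a v := by
  have hc := CStarModule.continuous_inner (A := A) (E := X)
  have hcl : IsClosed {q : X × X | (inner A q.2 u : A) = inner A q.1 v} :=
    isClosed_eq (hc.comp (continuous_snd.prodMk continuous_const))
      (hc.comp (continuous_fst.prodMk continuous_const))
  refine closure_minimal ?_ hcl (twist_subset_closure hd hδ hp hab)
  rintro ⟨a, b⟩ ⟨w, hw, hb⟩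
  change b = x w at hb
  change (inner A b u : A) = inner A a v
  rw [hb, hxs]
  exact hG _ _ _ _ hw huv

theorem boundedBelow_twist (hd : Dense {u : X | ∃ v, (u, v) ∈ G}) (hG : Symm A G)
    (hxs : ∀ u v : X, (inner A (x u) v : A) = inner A u (x v))
    (hδ : ∀ u v, (u, v) ∈ G → (x u, x v + δ u) ∈ G) {p : ℕ → X →L[ℂ] X}
    (hp : ∀ k, IsResolvent G ((((3 / 2) ^ k : ℝ) : ℂ) * Complex.I) (p k)) (t : ℝ) :
    BoundedBelow (twist G x δ) ((t : ℂ) * Complex.I) (|t| - ‖δ‖) := fun u v huv => by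
  refine norm_lower_bound (A := A) ?_ t
  rw [inner_twist hd hG hxs hδ hp huv (mem_twist.1 huv), CStarModule.inner_add_right, add_sub_cancel_left]
  have h1 := CStarModule.norm_inner_le (A := A) X (x := u) (y := δ u)
  have h2 := δ.le_opNorm u
  have h3 : 0 ≤ ‖δ‖ * ‖u‖ ^ 2 := by positivity
  nlinarith [norm_nonneg u]

/-! ### Bounded approximations of `xD`. -/

/-- The bounded approximation `m x z (1 - p)` of `x D`, for resolvents `p` and `m` of `D`. -/
noncomputable def approx (x : X →L[ℂ] X) (z : ℂ) (p m : X →L[ℂ] X) : X →L[ℂ] X :=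
  m.comp (x.comp (z • (ContinuousLinearMap.id ℂ X - p)))

theorem approx_apply (z : ℂ) (p m : X →L[ℂ] X) (u : X) :
    approx x z p m u = m (x (z • (u - p u))) := rfl

section Approx

variable {t : ℝ} {p m : X →L[ℂ] X}

/-- Since `m` is the adjoint of `p`, the defect `⟪Bu, u⟫ - ⟪u, Bu⟫` equals `⟪pu, δpu⟫`; the bound is
therefore independent of `t`. -/
theorem boundedBelow_approx (hG : Symm A G) (ht : t ≠ 0)
    (hxs : ∀ u v : X, (inner A (x u) v : A) = inner A u (x v))
    (hδ : ∀ u v, (u, v) ∈ G → (x u, x v + δ u) ∈ G)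
    (hp : IsResolvent G ((t : ℂ) * Complex.I) p)
    (hm : IsResolvent G (((-t : ℝ) : ℂ) * Complex.I) m) (r : ℝ) :
    BoundedBelow (approx x ((t : ℂ) * Complex.I) p m : X →ₗ[ℂ] X).graph
      ((r : ℂ) * Complex.I) (|r| - ‖δ‖) := fun u v huv => by
  have hv : v = m (x (((t : ℂ) * Complex.I) • (u - p u))) := huv
  refine norm_lower_bound (A := A) ?_ r
  have hadj := hG.inner_isResolvent ht hp hm
  have h1 : (inner A v u : A) = inner A (p u) (x (((t : ℂ) * Complex.I) • (u - p u)))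
      + inner A (p u) (δ (p u)) := by
    rw [hv, ← CStarModule.star_inner, ← hadj, CStarModule.star_inner, hxs,
      ← CStarModule.inner_add_right]
    exact hG _ _ _ _ (hp.mem u) (hδ _ _ (hp.mem u))
  have h2 : (inner A u v : A) = inner A (p u) (x (((t : ℂ) * Complex.I) • (u - p u))) := by
    rw [hv, hadj]
  rw [h1, h2, add_sub_cancel_left]
  have h3 := CStarModule.norm_inner_le (A := A) X (x := p u) (y := δ (p u))
  have h4 := δ.le_opNorm (p u)
  have h5 := hp.norm_apply_le u
  calc _ ≤ ‖p u‖ * (‖δ‖ * ‖p u‖) := h3.trans (by gcongr)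
    _ ≤ ‖u‖ * (‖δ‖ * ‖u‖) := by gcongr
    _ ≤ 2 * ‖δ‖ * ‖u‖ ^ 2 := by
      have : 0 ≤ ‖δ‖ * ‖u‖ ^ 2 := by positivity
      nlinarith

/-- Solutions of `(approx + i r) u = w` are bounded in the graph norm of `D`. -/
theorem exists_mem_of_approx (hd : Dense {u : X | ∃ v, (u, v) ∈ G}) (hG : Symm A G) (ht : t ≠ 0)
    (hxs : ∀ u v : X, (inner A (x u) v : A) = inner A u (x v))
    (hδ : ∀ u v, (u, v) ∈ G → (x u, x v + δ u) ∈ G)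
    (hp : IsResolvent G ((t : ℂ) * Complex.I) p)
    (hm : IsResolvent G (((-t : ℝ) : ℂ) * Complex.I) m) {r : ℝ} (hr : r ≠ 0) {u w w' : X}
    (hw : (w, w') ∈ G) (hu : approx x ((t : ℂ) * Complex.I) p m u + ((r : ℂ) * Complex.I) • u = w) :
    ∃ u', (u, u') ∈ G ∧ (|r| - 2 * ‖δ‖) * ‖u'‖ ≤ ‖w'‖ := by
  have hz : (r : ℂ) * Complex.I ≠ 0 :=
    mul_ne_zero (Complex.ofReal_ne_zero.2 hr) Complex.I_ne_zero
  set z := (r : ℂ) * Complex.I with hzdef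
  set B := approx x ((t : ℂ) * Complex.I) p m with hB
  -- `u = z⁻¹(w - Bu)`, and `B` takes values in the range of `m`, inside Dom(D).
  have hdom : ∃ u', (u, u') ∈ G := by
    have h1 := hm.mem (x (((t : ℂ) * Complex.I) • (u - p u)))
    rw [← approx_apply, ← hB] at h1
    have h2 := G.smul_mem z⁻¹ (G.sub_mem hw h1)
    have h3 : z⁻¹ • (w - B u) = u := by rw [← hu, add_sub_cancel_left, inv_smul_smul₀ hz]
    rw [Prod.mk_sub_mk, Prod.smul_mk, h3] at h2
    exact ⟨_, h2⟩
  obtain ⟨u', hu'⟩ := hdom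
  refine ⟨u', hu', ?_⟩
  -- The commutation rule `DB = BD + mδpD`. Thus `u'` solves the same equation up to an error of
  -- norm at most `‖δ‖‖u'‖`, which accounts for the second `‖δ‖` in the bound.
  have h1 : (B u, B u' + m (δ (p u'))) ∈ G := by
    have h2 := hm.apply_mem (hδ _ _ (hp.mem u'))
    rw [map_add] at h2
    have h3 : B u = m (x (p u')) := by rw [hB, approx_apply, ← hp.apply_snd _ _ hu']
    rw [h3]
    rwa [hB, approx_apply]
  have h2 : B u' + m (δ (p u')) + z • u' = w' := by
    refine hG.single_valued hd ?_ hw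
    rw [← hu]
    exact G.add_mem h1 (G.smul_mem z hu')
  have h3 := boundedBelow_approx hG ht hxs hδ hp hm r u' (B u') rfl
  have h4 : B u' + z • u' = w' - m (δ (p u')) := by
    rw [← h2]
    abel
  rw [← hzdef, h4] at h3
  have h5 : ‖m (δ (p u'))‖ ≤ ‖δ‖ * ‖u'‖ := by
    refine (hm.norm_apply_le _).trans ((δ.le_opNorm _).trans ?_)
    gcongr
    exact hp.norm_apply_le u'
  have h6 := norm_sub_le w' (m (δ (p u')))
  linarith

/-- After moving `m` and `p` across the inner product, only `v - pv` and `xv - m(xv)` remain. Both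
are `O(1/t)` because `v` and `xv` lie in the domain. -/
theorem norm_inner_approx_sub_le (hG : Symm A G) (ht : 0 < t)
    (hxs : ∀ u v : X, (inner A (x u) v : A) = inner A u (x v))
    (hδ : ∀ u v, (u, v) ∈ G → (x u, x v + δ u) ∈ G)
    (hp : IsResolvent G ((t : ℂ) * Complex.I) p)
    (hm : IsResolvent G (((-t : ℝ) : ℂ) * Complex.I) m) {u u' v v' : X}
    (hu : (u, u') ∈ G) (hv : (v, v') ∈ G) :
    ‖(inner A (approx x ((t : ℂ) * Complex.I) p m u) v : A) - inner A u' (x v)‖ ≤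
      t⁻¹ * (‖u'‖ * (2 * ‖x‖ * ‖v'‖ + ‖δ‖ * ‖v‖)) := by
  have hadj := hG.inner_isResolvent ht.ne' hp hm
  have hadj' : ∀ a b : X, (inner A (m a) b : A) = inner A a (p b) := fun a b => by
    rw [← CStarModule.star_inner, ← hadj, CStarModule.star_inner]
  have h1 : (inner A (approx x ((t : ℂ) * Complex.I) p m u) v : A) - inner A u' (x v)
      = -(inner A (x (p u')) (v - p v) + inner A u' (x v - m (x v))) := by
    rw [approx_apply, ← hp.apply_snd _ _ hu, hadj', CStarModule.inner_sub_right,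
      CStarModule.inner_sub_right, hxs (p u') v, hadj u' (x v)]
    abel
  have hnorm : ∀ s : ℝ, ‖(s : ℂ) * Complex.I‖ = |s| := fun s => by simp
  have h2 : ‖v - p v‖ ≤ t⁻¹ * ‖v'‖ := by
    have := hp.norm_sub_apply_le hv
    rw [hnorm, abs_of_pos ht] at this
    rwa [inv_mul_eq_div, le_div_iff₀' ht]
  have h3 : ‖x v - m (x v)‖ ≤ t⁻¹ * (‖x‖ * ‖v'‖ + ‖δ‖ * ‖v‖) := by
    have := hm.norm_sub_apply_le (hδ _ _ hv)
    rw [hnorm, abs_neg, abs_of_pos ht] at this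
    rw [inv_mul_eq_div, le_div_iff₀' ht]
    exact this.trans ((norm_add_le _ _).trans (add_le_add (x.le_opNorm _) (δ.le_opNorm _)))
  have h4 : ‖x (p u')‖ ≤ ‖x‖ * ‖u'‖ := by
    refine (x.le_opNorm _).trans ?_
    gcongr
    exact hp.norm_apply_le u'
  rw [h1, norm_neg]
  calc _ ≤ ‖x (p u')‖ * ‖v - p v‖ + ‖u'‖ * ‖x v - m (x v)‖ :=
        (norm_add_le _ _).trans
          (add_le_add (CStarModule.norm_inner_le X) (CStarModule.norm_inner_le X))
    _ ≤ (‖x‖ * ‖u'‖) * (t⁻¹ * ‖v'‖) + ‖u'‖ * (t⁻¹ * (‖x‖ * ‖v'‖ + ‖δ‖ * ‖v‖)) := by gcongr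
    _ = _ := by ring

end Approx

end Commutator

/-! ### Convergence of the approximate solutions and surjectivity. -/

section Commutator

variable {A X : Type*} [NonUnitalCStarAlgebra A] [PartialOrder A] [StarOrderedRing A]
  [SMul A X] [NormedAddCommGroup X] [NormedSpace ℂ X] [CStarModule A X]
  {G : Submodule ℂ (X × X)} {x δ : X →L[ℂ] X}

/-- Solutions of the approximating equations for two parameters `t₁` and `t₂` are close. -/
theorem norm_sub_sq_le_of_approx (hG : Symm A G)
    (hxs : ∀ u v : X, (inner A (x u) v : A) = inner A u (x v))
    (hδ : ∀ u v, (u, v) ∈ G → (x u, x v + δ u) ∈ G) {t₁ t₂ r M N : ℝ}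
    (ht₁ : 0 < t₁) (ht₂ : 0 < t₂) (hr : ‖δ‖ ≤ |r|) {p₁ m₁ p₂ m₂ : X →L[ℂ] X}
    (hp₁ : IsResolvent G ((t₁ : ℂ) * Complex.I) p₁)
    (hm₁ : IsResolvent G (((-t₁ : ℝ) : ℂ) * Complex.I) m₁)
    (hp₂ : IsResolvent G ((t₂ : ℂ) * Complex.I) p₂)
    (hm₂ : IsResolvent G (((-t₂ : ℝ) : ℂ) * Complex.I) m₂) {u₁ u₁' u₂ u₂' w : X}
    (h₁ : (u₁, u₁') ∈ G) (h₂ : (u₂, u₂') ∈ G)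
    (e₁ : approx x ((t₁ : ℂ) * Complex.I) p₁ m₁ u₁ + ((r : ℂ) * Complex.I) • u₁ = w)
    (e₂ : approx x ((t₂ : ℂ) * Complex.I) p₂ m₂ u₂ + ((r : ℂ) * Complex.I) • u₂ = w)
    (hN₁ : ‖u₁‖ ≤ N) (hN₂ : ‖u₂‖ ≤ N) (hM₁ : ‖u₁'‖ ≤ M) (hM₂ : ‖u₂'‖ ≤ M) :
    |r| * ‖u₁ - u₂‖ ^ 2 ≤
      2 * ((t₁⁻¹ + t₂⁻¹) * (M * (2 * ‖x‖ * (2 * M) + ‖δ‖ * (2 * N)))) := by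
  have hu : (u₁ - u₂, u₁' - u₂') ∈ G := G.sub_mem h₁ h₂
  have E₁ := norm_inner_approx_sub_le hG ht₁ hxs hδ hp₁ hm₁ h₁ hu
  have E₂ := norm_inner_approx_sub_le hG ht₂ hxs hδ hp₂ hm₂ h₂ hu
  set b₁ := approx x ((t₁ : ℂ) * Complex.I) p₁ m₁ u₁ with hb₁
  set b₂ := approx x ((t₂ : ℂ) * Complex.I) p₂ m₂ u₂ with hb₂
  set u := u₁ - u₂ with hudef
  set u' := u₁' - u₂' with hudef'
  have hnu : ‖u‖ ≤ 2 * N := (norm_sub_le _ _).trans (by linarith)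
  have hnu' : ‖u'‖ ≤ 2 * M := (norm_sub_le _ _).trans (by linarith)
  have hM : 0 ≤ M := (norm_nonneg _).trans hM₁
  set K := M * (2 * ‖x‖ * (2 * M) + ‖δ‖ * (2 * N)) with hK
  have F : ∀ {t : ℝ} {y : X}, 0 < t → ‖y‖ ≤ M →
      t⁻¹ * (‖y‖ * (2 * ‖x‖ * ‖u'‖ + ‖δ‖ * ‖u‖)) ≤ t⁻¹ * K := fun ht hy => by
    rw [hK]
    gcongr
  have hxu := hδ _ _ hu
  have hsymm : (inner A (x u) u' : A) = inner A u (x u') := hxs u u'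
  have hsymm' : (inner A u' (x u) : A) = inner A u (x u') + inner A u (δ u) := by
    rw [hG _ _ _ _ hu hxu, CStarModule.inner_add_right]
  have hstar : (inner A (x u) u' : A) = star (inner A u' (x u)) :=
    (CStarModule.star_inner _ _).symm
  have hdiff : b₁ - b₂ = -(((r : ℂ) * Complex.I) • u) := by
    rw [eq_sub_of_add_eq e₁, eq_sub_of_add_eq e₂, hudef, smul_sub]
    abel
  -- `e` is the difference of two weak approximation errors, hence small. The unknown `⟪u', xu⟫`
  -- enters `e - star e` only through its skew part `⟪u, δu⟫`, which half of `2|r|‖u‖²` absorbs.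
  let e : A := ((inner A b₁ u : A) - inner A u₁' (x u)) - (inner A b₂ u - inner A u₂' (x u))
  have he : e = ((r : ℂ) * Complex.I) • (inner A u u : A) - inner A u' (x u) := by
    have h1 : e = inner A (b₁ - b₂) u - inner A u' (x u) := by
      simp only [e, hudef', CStarModule.inner_sub_left]
      abel
    rw [h1, hdiff]
    simp
  have hne : ‖e‖ ≤ (t₁⁻¹ + t₂⁻¹) * K := by
    rw [add_mul]
    exact (norm_sub_le _ _).trans (add_le_add (E₁.trans (F ht₁ hM₁)) (E₂.trans (F ht₂ hM₂)))
  have hee : (2 * (r : ℂ) * Complex.I) • (inner A u u : A)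
      = (e - star e) + inner A u (δ u) := by
    rw [he, star_sub, ← hstar, hsymm, hsymm', star_smul, CStarModule.star_inner, star_mul',
      Complex.star_def, Complex.conj_ofReal, Complex.conj_I]
    module
  have hfin := congrArg norm hee
  rw [norm_smul, ← CStarModule.norm_sq_eq A, norm_mul, norm_mul, Complex.norm_I,
    Complex.norm_real, Complex.norm_ofNat, Real.norm_eq_abs, mul_one] at hfin
  have h5 : ‖(inner A u (δ u) : A)‖ ≤ ‖δ‖ * ‖u‖ ^ 2 := by
    refine (CStarModule.norm_inner_le X).trans ?_
    have := mul_le_mul_of_nonneg_left (δ.le_opNorm u) (norm_nonneg u)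
    calc _ ≤ _ := this
      _ = _ := by ring
  have h6 : ‖(e - star e) + inner A u (δ u)‖ ≤ 2 * ((t₁⁻¹ + t₂⁻¹) * K) + ‖δ‖ * ‖u‖ ^ 2 := by
    refine (norm_add_le _ _).trans (add_le_add ((norm_sub_le _ _).trans ?_) h5)
    rw [norm_star]
    linarith
  have h7 : ‖δ‖ * ‖u‖ ^ 2 ≤ |r| * ‖u‖ ^ 2 := by gcongr
  linarith

variable [CompleteSpace X]

/-- The lower bound and closedness reduce the claim to `w` in the dense Dom(D). There the uniform
bound on `Du` makes the approximation errors vanish. -/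
theorem surj_twist (hcl : IsClosed (G : Set (X × X)))
    (hd : Dense {u : X | ∃ v, (u, v) ∈ G}) (hG : Symm A G)
    (hself : ∀ u v : X, (∀ a b, (a, b) ∈ G → (inner A b u : A) = inner A a v) → (u, v) ∈ G)
    (hxs : ∀ u v : X, (inner A (x u) v : A) = inner A u (x v))
    (hδ : ∀ u v, (u, v) ∈ G → (x u, x v + δ u) ∈ G) {p m : ℕ → X →L[ℂ] X}
    (hp : ∀ k, IsResolvent G ((((3 / 2) ^ k : ℝ) : ℂ) * Complex.I) (p k))
    (hm : ∀ k, IsResolvent G (((-(3 / 2) ^ k : ℝ) : ℂ) * Complex.I) (m k))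
    {r : ℝ} (hr : 2 * ‖δ‖ < |r|) : Surj (twist G x δ) ((r : ℂ) * Complex.I) := by
  have hδ0 := norm_nonneg δ
  refine Surj.of_dense (isClosed_twist hcl) (c := |r| - ‖δ‖) (by linarith)
    (boundedBelow_twist hd hG hxs hδ hp r) (hd.mono ?_)
  rintro w ⟨w', hw⟩
  have hr0 : r ≠ 0 := abs_pos.1 (by linarith)
  have hpos : ∀ k : ℕ, 0 < (3 / 2 : ℝ) ^ k := fun k => by positivity
  let B : ℕ → X →L[ℂ] X := fun k =>
    approx x ((((3 / 2) ^ k : ℝ) : ℂ) * Complex.I) (p k) (m k)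
  have hBb : ∀ k, ∀ r : ℝ, BoundedBelow (B k : X →ₗ[ℂ] X).graph ((r : ℂ) * Complex.I)
      (|r| - ‖δ‖) := fun k => boundedBelow_approx hG (hpos k).ne' hxs hδ (hp k) (hm k)
  have hsol : ∀ k, ∃ u, B k u + ((r : ℂ) * Complex.I) • u = w := fun k => by
    obtain ⟨u, v, huv, h⟩ :=
      surj_graph_of_boundedBelow (B k) (t := r) (by linarith) hδ0 (hBb k) w
    exact ⟨u, by rw [← h]; congr 1; exact huv.symm⟩
  choose u hu using hsol
  have hdom : ∀ k, ∃ u', (u k, u') ∈ G ∧ (|r| - 2 * ‖δ‖) * ‖u'‖ ≤ ‖w'‖ := fun k =>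
    exists_mem_of_approx hd hG (hpos k).ne' hxs hδ (hp k) (hm k) hr0 hw (hu k)
  choose u' hu' hM using hdom
  have hM' : ∀ k, ‖u' k‖ ≤ ‖w'‖ / (|r| - 2 * ‖δ‖) := fun k => by
    rw [le_div_iff₀' (by linarith)]
    exact hM k
  have hN : ∀ k, ‖u k‖ ≤ ‖w‖ / (|r| - ‖δ‖) := fun k => by
    rw [le_div_iff₀' (by linarith)]
    have := hBb k r (u k) (B k (u k)) rfl
    rwa [hu k] at this
  set M := ‖w'‖ / (|r| - 2 * ‖δ‖)
  set N := ‖w‖ / (|r| - ‖δ‖)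
  have hM0 : 0 ≤ M := (norm_nonneg _).trans (hM' 0)
  have hN0 : 0 ≤ N := (norm_nonneg _).trans (hN 0)
  set K := M * (2 * ‖x‖ * (2 * M) + ‖δ‖ * (2 * N)) with hK
  have hK0 : 0 ≤ K := by positivity
  have hinv : Tendsto (fun k : ℕ => ((3 / 2 : ℝ) ^ k)⁻¹) atTop (𝓝 0) :=
    (tendsto_pow_atTop_atTop_of_one_lt (by norm_num)).inv_tendsto_atTop
  have hcauchy : CauchySeq u := by
    refine cauchySeq_of_le_tendsto_0
      (fun k => √(4 * K / |r| * ((3 / 2 : ℝ) ^ k)⁻¹)) (fun i j k hi hj => ?_) ?_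
    · rw [dist_eq_norm]
      refine Real.le_sqrt_of_sq_le ?_
      have h1 := norm_sub_sq_le_of_approx hG hxs hδ (hpos i) (hpos j) (by linarith : ‖δ‖ ≤ |r|)
        (hp i) (hm i) (hp j) (hm j) (hu' i) (hu' j) (hu i) (hu j) (hN i) (hN j) (hM' i) (hM' j)
      have h2 : ∀ {l : ℕ}, k ≤ l → ((3 / 2 : ℝ) ^ l)⁻¹ ≤ ((3 / 2 : ℝ) ^ k)⁻¹ := fun hl =>
        inv_anti₀ (hpos k) (pow_le_pow_right₀ (by norm_num) hl)
      have h3 : (((3 / 2 : ℝ) ^ i)⁻¹ + ((3 / 2 : ℝ) ^ j)⁻¹) * K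
          ≤ (2 * ((3 / 2 : ℝ) ^ k)⁻¹) * K := by
        gcongr
        linarith [h2 hi, h2 hj]
      have hr' : 0 < |r| := by linarith
      rw [div_mul_eq_mul_div, le_div_iff₀' hr']
      linarith
    · have h := (hinv.const_mul (4 * K / |r|)).sqrt
      simpa using h
  obtain ⟨v, hv⟩ := cauchySeq_tendsto_of_complete hcauchy
  -- It suffices to test `xv` against the graph of `D`: selfadjointness puts `xv` in Dom(D) without
  -- strong convergence of `D(xu)`.
  refine ⟨v, w - ((r : ℂ) * Complex.I) • v, mem_twist.2 (hself _ _ fun a b hab => ?_), by simp⟩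
  have hskew := inner_skew hd hG hxs hδ
  have hlim1 : Tendsto (fun k => (inner A (B k (u k)) a : A)) atTop
      (𝓝 (inner A (w - ((r : ℂ) * Complex.I) • v) a)) := by
    have h1 : ∀ k, B k (u k) = w - ((r : ℂ) * Complex.I) • u k := fun k => eq_sub_of_add_eq (hu k)
    simp only [h1]
    exact tendsto_inner (tendsto_const_nhds.sub (hv.const_smul _)) tendsto_const_nhds
  have hlim2 : Tendsto (fun k => (inner A (u' k) (x a) : A)) atTop
      (𝓝 (inner A v (x b + δ a))) := by
    have h1 : ∀ k, (inner A (u' k) (x a) : A) = inner A (u k) (x b + δ a) := fun k =>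
      hG _ _ _ _ (hu' k) (hδ _ _ hab)
    simp only [h1]
    exact tendsto_inner hv tendsto_const_nhds
  have hlim3 : Tendsto (fun k => (inner A (B k (u k)) a : A) - inner A (u' k) (x a)) atTop
      (𝓝 0) := by
    refine squeeze_zero_norm (a := fun k =>
      ((3 / 2 : ℝ) ^ k)⁻¹ * (M * (2 * ‖x‖ * ‖b‖ + ‖δ‖ * ‖a‖))) (fun k => ?_) ?_
    · refine (norm_inner_approx_sub_le hG (hpos k) hxs hδ (hp k) (hm k) (hu' k) hab).trans ?_
      gcongr
      exact hM' k
    · simpa using hinv.mul_const (M * (2 * ‖x‖ * ‖b‖ + ‖δ‖ * ‖a‖))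
  have heq : (inner A (w - ((r : ℂ) * Complex.I) • v) a : A) = inner A v (x b + δ a) :=
    sub_eq_zero.1 (tendsto_nhds_unique (hlim1.sub hlim2) hlim3)
  have heq' : (inner A (x v) b : A) = inner A (w - ((r : ℂ) * Complex.I) • v + δ v) a := by
    rw [CStarModule.inner_add_left, heq, CStarModule.inner_add_right, hskew, hxs]
    abel
  rw [← CStarModule.star_inner, heq', CStarModule.star_inner]

/-- `1 + (D x) (D x - δ)` is surjective. -/
theorem exists_one_add_twist (hcl : IsClosed (G : Set (X × X)))
    (hd : Dense {u : X | ∃ v, (u, v) ∈ G}) (hG : Symm A G)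
    (hself : ∀ u v : X, (∀ a b, (a, b) ∈ G → (inner A b u : A) = inner A a v) → (u, v) ∈ G)
    (hxs : ∀ u v : X, (inner A (x u) v : A) = inner A u (x v))
    (hδ : ∀ u v, (u, v) ∈ G → (x u, x v + δ u) ∈ G) {p m : ℕ → X →L[ℂ] X}
    (hp : ∀ k, IsResolvent G ((((3 / 2) ^ k : ℝ) : ℂ) * Complex.I) (p k))
    (hm : ∀ k, IsResolvent G (((-(3 / 2) ^ k : ℝ) : ℂ) * Complex.I) (m k)) (w : X) :
    ∃ a b v, (a, b) ∈ twist G x δ ∧ (x b, v) ∈ G ∧ a + v = w := by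
  -- The graph of `(Dx)(Dx - δ)`.
  let H : Submodule ℂ (X × X) :=
    { carrier := {q | ∃ b, (q.1, b) ∈ twist G x δ ∧ (x b, q.2) ∈ G}
      add_mem' := by
        rintro q q' ⟨b, h1, h2⟩ ⟨b', h1', h2'⟩
        exact ⟨b + b', (twist G x δ).add_mem h1 h1', by
          rw [map_add]
          exact G.add_mem h2 h2'⟩
      zero_mem' := ⟨0, (twist G x δ).zero_mem, by
        rw [map_zero]
        exact G.zero_mem⟩
      smul_mem' := by
        rintro z q ⟨b, h1, h2⟩
        exact ⟨z • b, (twist G x δ).smul_mem z h1, by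
          rw [map_smul]
          exact G.smul_mem z h2⟩ }
  have hδ0 := norm_nonneg δ
  -- Large enough for `t > 2‖δ‖`, for `‖δ‖/(t-‖δ‖) ≤ 1/4` and `t/(t-‖δ‖) ≤ 5/4`, hence `‖K‖ ≤ 9/16`,
  -- and for `t ≥ 1`.
  set t : ℝ := 5 * ‖δ‖ + 1 with ht
  have hc : 0 < t - ‖δ‖ := by linarith
  have htabs : |t| = t := abs_of_pos (by linarith)
  have hb := boundedBelow_twist hd hG hxs hδ hp t
  have hb' := boundedBelow_twist hd hG hxs hδ hp (-t)
  rw [htabs] at hb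
  rw [abs_neg, htabs] at hb'
  obtain ⟨R, hR, hRn⟩ := exists_inverse hc hb
    (surj_twist hcl hd hG hself hxs hδ hp hm (by rw [htabs]; linarith))
  obtain ⟨R', hR', hRn'⟩ := exists_inverse hc hb'
    (surj_twist hcl hd hG hself hxs hδ hp hm (by rw [abs_neg, htabs]; linarith))
  -- Positivity: `⟪a, v⟫ = ⟪b, b⟫`, because `Dx` lies in the adjoint of `Dx - δ`.
  have hHb : BoundedBelow H ((t ^ 2 : ℝ) : ℂ) (t ^ 2) := by
    rintro a v ⟨b, hab, hbv⟩
    have h1 : (inner A a (v + ((t ^ 2 : ℝ) : ℂ) • a) : A)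
        = inner A b b + ((t ^ 2 : ℝ) : ℂ) • inner A a a := by
      rw [CStarModule.inner_add_right, CStarModule.inner_smul_right_complex,
        inner_twist hd hG hxs hδ hp hab hbv]
    have h0 : (0 : A) ≤ ((t ^ 2 : ℝ) : ℂ) • inner A a a := by
      rw [Complex.coe_smul]
      exact smul_nonneg (by positivity) CStarModule.inner_self_nonneg
    have h2 : ‖((t ^ 2 : ℝ) : ℂ) • (inner A a a : A)‖ ≤ ‖a‖ * ‖v + ((t ^ 2 : ℝ) : ℂ) • a‖ := by
      refine (CStarAlgebra.norm_le_norm_of_nonneg_of_le h0 ?_).trans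
        (CStarModule.norm_inner_le (A := A) X)
      rw [h1]
      exact le_add_of_nonneg_left CStarModule.inner_self_nonneg
    rw [norm_smul, ← CStarModule.norm_sq_eq A, Complex.norm_real, Real.norm_eq_abs,
      abs_of_nonneg (by positivity)] at h2
    rcases (norm_nonneg a).eq_or_lt with h3 | h3
    · rw [← h3, mul_zero]
      exact norm_nonneg _
    · refine le_of_mul_le_mul_left ?_ h3
      linarith
  have hHs : Surj H ((t ^ 2 : ℝ) : ℂ) := by
    intro w
    have hRle : ∀ y, ‖R y‖ ≤ (t - ‖δ‖)⁻¹ * ‖y‖ := fun y => by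
      rw [inv_mul_eq_div, le_div_iff₀' hc]
      exact hRn y
    have hRle' : ∀ y, ‖R' y‖ ≤ (t - ‖δ‖)⁻¹ * ‖y‖ := fun y => by
      rw [inv_mul_eq_div, le_div_iff₀' hc]
      exact hRn' y
    -- `K = δ T R' R`, using `T R' = 1 + it R'`. As `(T+it)(T-it)R'R = 1`, applying `t² + (T+δ)T` to
    -- `R'R` gives `1 + K`.
    let K : X →L[ℂ] X := δ.comp (R + ((t : ℂ) * Complex.I) • R'.comp R)
    have hK : ‖K‖ < 1 := by
      refine (K.opNorm_le_bound (M := 9 / 16) (by norm_num) fun y => ?_).trans_lt (by norm_num)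
      have h1 : ‖K y‖ ≤ ‖δ‖ * (‖R y‖ + t * ‖R' (R y)‖) := by
        refine (δ.le_opNorm _).trans ?_
        gcongr
        refine (norm_add_le _ _).trans (le_of_eq ?_)
        change ‖R y‖ + ‖((t : ℂ) * Complex.I) • R' (R y)‖ = _
        rw [norm_smul, norm_mul, Complex.norm_I, mul_one, Complex.norm_real, Real.norm_eq_abs,
          htabs]
      set s := (t - ‖δ‖)⁻¹ with hs
      have hs0 : 0 ≤ s := by positivity
      have hs1 : (t - ‖δ‖) * s = 1 := mul_inv_cancel₀ hc.ne'
      have hs2 : ‖δ‖ * s ≤ 1 / 4 := by nlinarith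
      have hs3 : t * s ≤ 5 / 4 := by nlinarith
      have h2 := hRle y
      have h3 : t * ‖R' (R y)‖ ≤ 5 / 4 * ‖R y‖ := by
        calc t * ‖R' (R y)‖ ≤ t * (s * ‖R y‖) := by gcongr; exact hRle' _
          _ = t * s * ‖R y‖ := by ring
          _ ≤ _ := by gcongr
      calc ‖K y‖ ≤ ‖δ‖ * (‖R y‖ + t * ‖R' (R y)‖) := h1
        _ ≤ ‖δ‖ * (‖R y‖ + 5 / 4 * ‖R y‖) := by gcongr
        _ = 9 / 4 * ‖δ‖ * ‖R y‖ := by ring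
        _ ≤ 9 / 4 * ‖δ‖ * (s * ‖y‖) := by gcongr
        _ = 9 / 4 * (‖δ‖ * s) * ‖y‖ := by ring
        _ ≤ 9 / 4 * (1 / 4) * ‖y‖ := by gcongr
        _ = 9 / 16 * ‖y‖ := by ring
    obtain ⟨y, hy⟩ := exists_add_apply_eq K hK w
    set z : ℂ := (t : ℂ) * Complex.I with hz
    have hz2 : z * z = -((t ^ 2 : ℝ) : ℂ) := by
      rw [hz, mul_mul_mul_comm, Complex.I_mul_I]
      push_cast
      ring
    have h1 : (R y, y - z • R y) ∈ twist G x δ := hR y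
    have h2 : (R' (R y), R y + z • R' (R y)) ∈ twist G x δ := by
      have := hR' (R y)
      rw [Complex.ofReal_neg, neg_mul, neg_smul, sub_neg_eq_add] at this
      exact this
    have h3 := (twist G x δ).add_mem h1 ((twist G x δ).smul_mem z h2)
    refine ⟨R' (R y), _, ⟨R y + z • R' (R y), h2, mem_twist.1 h3⟩, ?_⟩
    rw [← hy]
    change (y - z • R y + z • (R y + z • R' (R y))) + δ (R y + z • R' (R y))
      + ((t ^ 2 : ℝ) : ℂ) • R' (R y) = y + δ (R y + z • R' (R y))
    rw [smul_add, smul_smul, hz2, neg_smul]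
    abel
  -- The shift has size `t² - 1`, just below the lower bound `t²`.
  have hH1 : Surj H 1 := by
    refine hHs.of_norm_sub_lt hHb ?_
    have ht1 : 1 ≤ t := by linarith
    have : (1 : ℂ) - ((t ^ 2 : ℝ) : ℂ) = ((1 - t ^ 2 : ℝ) : ℂ) := by push_cast; ring
    rw [this, Complex.norm_real, Real.norm_eq_abs, abs_of_nonpos (by nlinarith)]
    linarith
  obtain ⟨a, v, ⟨b, h1, h2⟩, h3⟩ := hH1 w
  exact ⟨a, b, v, h1, h2, by rw [← h3, one_smul, add_comm]⟩

end Commutator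

/-! ### Translation between partially defined operators and their graphs. -/

section Operators

variable {A X : Type*} [NonUnitalCStarAlgebra A] [PartialOrder A] [StarOrderedRing A]
  [SMul A X] [NormedAddCommGroup X] [NormedSpace ℂ X] [CStarModule A X]

theorem coe_domain_eq (T : X →ₗ.[ℂ] X) :
    (T.domain : Set X) = {u | ∃ v, (u, v) ∈ T.graph} := by
  ext u
  constructor
  · intro hu
    exact ⟨T ⟨u, hu⟩, T.mem_graph ⟨u, hu⟩⟩
  · rintro ⟨v, hv⟩
    exact T.mem_domain_of_mem_graph hv

theorem mem_adjointGraph {T : X →ₗ.[ℂ] X} {u v : X} :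
    (u, v) ∈ adjointGraph A T ↔
      ∀ a b, (a, b) ∈ T.graph → (inner A b u : A) = inner A a v := by
  constructor
  · intro h a b hab
    obtain ⟨ξ, rfl, rfl⟩ := (LinearPMap.mem_graph_iff _).1 hab
    exact h ξ
  · intro h ξ
    exact h _ _ (T.mem_graph ξ)

theorem graph_adjoint {T : X →ₗ.[ℂ] X} (hd : Dense (T.domain : Set X)) :
    (adjoint A T).graph = adjointGraph A T := by
  refine Submodule.toLinearPMap_graph_eq _ ?_
  rintro ⟨u, v⟩ h h0
  change u = 0 at h0
  subst h0
  refine ext_inner_left_dense (A := A) hd fun w hw => ?_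
  rw [← mem_adjointGraph.1 h _ _ (T.mem_graph ⟨w, hw⟩), CStarModule.inner_zero_right,
    CStarModule.inner_zero_right]

theorem exists_compose_eq {S T : X →ₗ.[ℂ] X} {a b v : X} (hT : (a, b) ∈ T.graph)
    (hS : (b, v) ∈ S.graph) :
    ∃ ξ : (compose S T).domain, (ξ : X) = a ∧ compose S T ξ = v := by
  obtain ⟨⟨a, ha⟩, rfl, rfl⟩ := (LinearPMap.mem_graph_iff _).1 hT
  obtain ⟨⟨b, hb⟩, hb', rfl⟩ := (LinearPMap.mem_graph_iff _).1 hS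
  change b = T ⟨a, ha⟩ at hb'
  subst hb'
  exact ⟨⟨a, ha, hb⟩, rfl, rfl⟩

theorem mem_graph_of_compose {S T : X →ₗ.[ℂ] X} (ξ : (compose S T).domain) :
    ∃ b, ((ξ : X), b) ∈ T.graph ∧ (b, compose S T ξ) ∈ S.graph := by
  obtain ⟨ξ, h, h'⟩ := ξ
  exact ⟨T ⟨ξ, h⟩, T.mem_graph ⟨ξ, h⟩, S.mem_graph ⟨_, h'⟩⟩

theorem mem_graph_mulLeft {D : X →ₗ.[ℂ] X} {x : X →L[ℂ] X} {u v : X} :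
    (u, v) ∈ (mulLeft x D).graph ↔ ∃ w, (u, w) ∈ D.graph ∧ v = x w := by
  constructor
  · intro h
    obtain ⟨ξ, rfl, rfl⟩ := (LinearPMap.mem_graph_iff _).1 h
    exact ⟨D ξ, D.mem_graph ξ, rfl⟩
  · rintro ⟨w, h, rfl⟩
    obtain ⟨ξ, rfl, rfl⟩ := (LinearPMap.mem_graph_iff _).1 h
    exact (mulLeft x D).mem_graph ξ

theorem graph_mulRight_sub {D : X →ₗ.[ℂ] X} {x δ : X →L[ℂ] X} :
    (mulRight D x - (δ : X →ₗ[ℂ] X).toPMap ⊤).graph = twist D.graph x δ := by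
  ext ⟨u, v⟩
  rw [mem_twist]
  constructor
  · intro h
    obtain ⟨⟨ξ, hξ⟩, rfl, rfl⟩ := (LinearPMap.mem_graph_iff _).1 h
    have h1 : x ξ ∈ D.domain := hξ.1
    have h2 : (mulRight D x - (δ : X →ₗ[ℂ] X).toPMap ⊤) ⟨ξ, hξ⟩ = D ⟨x ξ, h1⟩ - δ ξ := rfl
    rw [h2, sub_add_cancel]
    exact D.mem_graph ⟨x ξ, h1⟩
  · intro h
    obtain ⟨⟨y, hy⟩, hyu, hv⟩ := (LinearPMap.mem_graph_iff _).1 h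
    change y = x u at hyu
    subst hyu
    have hu : u ∈ (mulRight D x - (δ : X →ₗ[ℂ] X).toPMap ⊤).domain := ⟨hy, trivial⟩
    have h2 : (mulRight D x - (δ : X →ₗ[ℂ] X).toPMap ⊤) ⟨u, hu⟩ = v := by
      change D ⟨x u, hy⟩ - δ u = v
      change D ⟨x u, hy⟩ = v + δ u at hv
      rw [hv, add_sub_cancel_right]
    exact (LinearPMap.mem_graph_iff _).2 ⟨⟨u, hu⟩, rfl, h2⟩

/-- A formal adjoint forces `A`-linearity, as the action passes through the second slot of the inner
product. It serves for `x` and for the skew-adjoint `δ`. -/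
theorem map_smul_of_adjointable {y z : X → X}
    (h : ∀ u v : X, (inner A (y u) v : A) = inner A u (z v)) (a : A) (u : X) :
    y (a • u) = a • y u := by
  refine ext_inner_left_dense (A := A) dense_univ fun w _ => ?_
  rw [← CStarModule.star_inner, h, CStarModule.star_inner, CStarModule.inner_op_smul_right,
    CStarModule.inner_op_smul_right, ← CStarModule.star_inner (y u), h, CStarModule.star_inner]

/-- `X` carries only `SMul A X`; additivity follows from definiteness of the inner product. -/
theorem module_smul_add (a : A) (u v : X) : a • (u + v) = a • u + a • v := by
  refine ext_inner_left_dense (A := A) dense_univ fun w _ => ?_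
  simp [mul_add]

theorem IsRegular.smul_mem_graph {T : X →ₗ.[ℂ] X} (hT : IsRegular A T) (a : A) {u v : X}
    (h : (u, v) ∈ T.graph) : (a • u, a • v) ∈ T.graph := by
  obtain ⟨⟨u, hu⟩, rfl, rfl⟩ := (LinearPMap.mem_graph_iff _).1 h
  rw [← hT.map_smul a u hu (hT.smul_mem a u hu)]
  exact T.mem_graph ⟨_, hT.smul_mem a u hu⟩

theorem IsRegular.dense_fst_graph {T : X →ₗ.[ℂ] X} (hT : IsRegular A T) :
    Dense {u : X | ∃ v, (u, v) ∈ T.graph} := by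
  rw [← coe_domain_eq]
  exact hT.dense_domain

theorem IsRegular.mem_graph_iff_of_adjoint_eq {T : X →ₗ.[ℂ] X} (hT : IsRegular A T)
    (hsa : adjoint A T = T) {u v : X} :
    (u, v) ∈ T.graph ↔ ∀ a b, (a, b) ∈ T.graph → (inner A b u : A) = inner A a v := by
  rw [← mem_adjointGraph, ← graph_adjoint hT.dense_domain, hsa]

theorem IsRegular.symm_graph {T : X →ₗ.[ℂ] X} (hT : IsRegular A T) (hsa : adjoint A T = T) :
    Symm A T.graph := fun _ _ _ _ h h' => (hT.mem_graph_iff_of_adjoint_eq hsa).1 h' _ _ h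

/-- A selfadjoint regular operator `T` has `T + z` surjective for `z² = -1`. -/
theorem IsRegular.surj_graph [CompleteSpace X] {T : X →ₗ.[ℂ] X} (hT : IsRegular A T)
    (hsa : adjoint A T = T) {e : ℝ} (he : e * e = 1) :
    Surj T.graph ((e : ℂ) * Complex.I) := by
  have he0 : e ≠ 0 := fun h => by simp [h] at he
  refine Surj.of_dense hT.isClosed (abs_pos.2 he0)
    ((hT.symm_graph hsa).boundedBelow e) (hT.dense_range.mono ?_)
  rintro w ⟨ξ, rfl⟩
  obtain ⟨b, h1, h2⟩ := mem_graph_of_compose ξ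
  generalize compose (adjoint A T) T ξ = c at h2 ⊢
  rw [hsa] at h2
  set z : ℂ := (e : ℂ) * Complex.I with hz
  have hz2 : z * z = -1 := by
    rw [hz, mul_mul_mul_comm, Complex.I_mul_I, ← Complex.ofReal_mul, he]
    simp
  -- Factorisation `1 + T² = (T + z)(T - z)`.
  refine ⟨b - z • (ξ : X), c - z • b, T.graph.sub_mem h2 (T.graph.smul_mem z h1), ?_⟩
  rw [smul_sub, smul_smul, hz2, neg_one_smul]
  abel

theorem delta_spec [CompleteSpace X] {D : X →ₗ.[ℂ] X} {x : X →L[ℂ] X}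
    (hd : Dense (D.domain : Set X)) (hx : ∀ ξ ∈ D.domain, x ξ ∈ D.domain)
    (hb : ∃ C : ℝ, ∀ ξ : D.domain, ‖commutator D x hx ξ‖ ≤ C * ‖ξ‖) {u v : X}
    (huv : (u, v) ∈ D.graph) : (x u, x v + delta D x hx hb u) ∈ D.graph := by
  obtain ⟨ξ, rfl, rfl⟩ := (LinearPMap.mem_graph_iff _).1 huv
  have h1 : delta D x hx hb (ξ : X) = commutator D x hx ξ := by
    refine ContinuousLinearMap.extend_eq _ (e := D.domain.subtypeL) ?_ ?_ ξ
    · exact hd.denseRange_val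
    · exact isUniformEmbedding_subtype_val.isUniformInducing
  have h2 : commutator D x hx ξ = D ⟨x ξ, hx ξ ξ.2⟩ - x (D ξ) := rfl
  rw [h1, h2, add_sub_cancel]
  exact D.mem_graph ⟨x ξ, hx ξ ξ.2⟩

end Operators

end HilbertModule

/-! ### The main theorem. -/

theorem propositionp {A X : Type*} [NonUnitalCStarAlgebra A] [PartialOrder A] [StarOrderedRing A]
    [SMul A X] [NormedAddCommGroup X] [NormedSpace ℂ X] [CompleteSpace X] [CStarModule A X]
    (D : X →ₗ.[ℂ] X) (hDreg : HilbertModule.IsRegular A D)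
    (hDsa : HilbertModule.adjoint A D = D)
    (x : X →L[ℂ] X) (hxsa : ∀ ξ η : X, inner A (x ξ) η = inner A ξ (x η))
    (hx : ∀ ξ ∈ D.domain, x ξ ∈ D.domain)
    (hb : ∃ C : ℝ, ∀ ξ : D.domain, ‖HilbertModule.commutator D x hx ξ‖ ≤ C * ‖ξ‖) :
    (HilbertModule.mulLeft x D).IsClosable ∧
      HilbertModule.IsRegular A (HilbertModule.mulLeft x D).closure ∧
      (HilbertModule.mulLeft x D).closure =
        HilbertModule.mulRight D x -
          (HilbertModule.delta D x hx hb : X →ₗ[ℂ] X).toPMap ⊤ := by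
  open HilbertModule in
  have hδ : ∀ u v, (u, v) ∈ D.graph → (x u, x v + delta D x hx hb u) ∈ D.graph :=
    fun u v h => delta_spec hDreg.dense_domain hx hb h
  set δ := delta D x hx hb
  have hd := hDreg.dense_fst_graph
  have hG := hDreg.symm_graph hDsa
  have hself : ∀ u v : X, (∀ a b, (a, b) ∈ D.graph → (inner A b u : A) = inner A a v) →
      (u, v) ∈ D.graph := fun u v => (hDreg.mem_graph_iff_of_adjoint_eq hDsa).2
  obtain ⟨p, m, hp, hm⟩ := hG.exists_resolvents
    (by simpa using hDreg.surj_graph hDsa (e := 1) (by norm_num))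
    (by simpa using hDreg.surj_graph hDsa (e := -1) (by norm_num))
  set S := mulRight D x - (δ : X →ₗ[ℂ] X).toPMap ⊤ with hS
  have hSg : S.graph = twist D.graph x δ := graph_mulRight_sub
  have hSc : S.IsClosed := by
    rw [LinearPMap.IsClosed, hSg]
    exact isClosed_twist hDreg.isClosed
  have hcl : (mulLeft x D).graph.topologicalClosure = S.graph := by
    refine le_antisymm ((mulLeft x D).graph.topologicalClosure_minimal ?_ hSc) ?_
    · rintro ⟨u, v⟩ h
      obtain ⟨w, hw, rfl⟩ := mem_graph_mulLeft.1 h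
      rw [hSg, mem_twist]
      exact hδ _ _ hw
    · rintro ⟨u, v⟩ h
      rw [hSg] at h
      refine closure_mono ?_ (twist_subset_closure hd hδ hp h)
      rintro ⟨a, b⟩ h'
      exact mem_graph_mulLeft.2 h'
  have hclosable : (mulLeft x D).IsClosable := ⟨S, hcl⟩
  have heq : (mulLeft x D).closure = S :=
    LinearPMap.eq_of_eq_graph (by rw [← hclosable.graph_closure_eq_closure_graph, hcl])
  have hmem : ∀ u v, (u, v) ∈ D.graph → (u, x v) ∈ S.graph := fun u v h => by
    rw [hSg]
    exact hδ _ _ h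
  have hdS : Dense (S.domain : Set X) := by
    rw [coe_domain_eq]
    refine hd.mono ?_
    rintro u ⟨v, hv⟩
    exact ⟨_, hmem u v hv⟩
  -- Only the inclusion of `Dx` in the adjoint is needed: a larger adjoint only enlarges its domain
  -- and the range of `1 + S*S`.
  have hadj : ∀ u v, (x u, v) ∈ D.graph → (u, v) ∈ (adjoint A S).graph := fun u v h => by
    rw [graph_adjoint hdS, mem_adjointGraph]
    intro a b hab
    rw [hSg] at hab
    exact inner_twist hd hG hxsa hδ hp hab h
  have hsmul : ∀ (a : A) u v, (u, v) ∈ S.graph → (a • u, a • v) ∈ S.graph := fun a u v h => by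
    rw [hSg, mem_twist] at h ⊢
    have hskew := inner_skew hd hG hxsa hδ
    rw [map_smul_of_adjointable hxsa, map_smul_of_adjointable (y := δ) (z := fun v => -δ v)
      (fun u v => by rw [hskew, CStarModule.inner_neg_right]), ← module_smul_add]
    exact hDreg.smul_mem_graph a h
  refine ⟨hclosable, ?_, heq⟩
  rw [heq]
  refine ⟨fun a ξ h => ?_, fun a ξ h h' => ?_, hSc, hdS, ?_, ?_⟩
  · exact S.mem_domain_of_mem_graph (hsmul a _ _ (S.mem_graph ⟨ξ, h⟩))
  · exact (S.mem_graph_snd_inj (S.mem_graph ⟨_, h'⟩) (hsmul a _ _ (S.mem_graph ⟨ξ, h⟩)) rfl)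
  · rw [coe_domain_eq]
    refine hd.mono ?_
    rintro u ⟨v, hv⟩
    exact ⟨_, hadj _ _ (hδ u v hv)⟩
  · refine dense_univ.mono fun w _ => ?_
    obtain ⟨a, b, v, h1, h2, rfl⟩ :=
      exists_one_add_twist hDreg.isClosed hd hG hself hxsa hδ hp hm w
    rw [← hSg] at h1
    obtain ⟨ξ, rfl, rfl⟩ := exists_compose_eq h1 (hadj _ _ h2)
    exact ⟨ξ, rfl⟩
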